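/- Let $H$ be an infinite-dimensional separable complex Hilbert space with a fixed orthonormal basis $\{e_n : n \ge 1\}$. Let $\mathcal D$ be the algebra of bounded operators on $H$ that are diagonal with respect to this basis, let $\mathcal K$ be the ideal of compact operators on $H$, and let $\mathcal D+\mathcal K=\{D+K : D\in\mathcal D,\ K\in\mathcal K\}$, a unital $*$-subalgebra of $\mathcal B(H)$. For a compact self-adjoint operator $X$ on $H$ let $\theta_X$ be the $*$-automorphism $T\mapsto e^{iX}Te^{-iX}$ of $\mathcal D+\mathcal K$. For a permutation $\sigma$ of $\mathbb N$ let $U_\sigma$ be the unitary operator on $H$ with $U_\sigma e_n=e_{\sigma(n)}$ for all $n$, and let $\theta_\sigma$ be the $*$-automorphism $T\mapsto U_\sigma TU_\sigma^*$ of $\mathcal D+\mathcal K$. For a bounded operator $T$ write $n(T)$ for the dimension of its null space and $r(T)$ for the dimension of its range, as elements of $\{0,1,2,\dots\}\cup\{\infty\}$. **Proposition.** Let $P,Q\in\mathcal D+\mathcal K$ be orthogonal projections with $n(P)=n(Q)$ and $r(P)=r(Q)$. Then there is a $*$-automorphism $\theta$ of $\mathcal D+\mathcal K$ with $\theta(P)=Q$.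 More precisely, there are compact self-adjoint operators $X,Y$ on $H$ and a permutation $\sigma$ of $\mathbb N$ such that $$\theta_Y\,\theta_\sigma\,\theta_{-X}(P)=Q .$$ -/

import Mathlib

namespace DiagonalPlusCompact

noncomputable section

variable {H : Type*} [NormedAddCommGroup H] [InnerProductSpace ℂ H] [CompleteSpace H]

/-! ### The algebra of diagonal plus compact operators -/

/-- `T` is diagonal with respect to the orthonormal basis `b`: there is a sequence of entries
`x n` with `T (b n) = x n • b n` (such a sequence is bounded, since `T` is). -/
def IsDiagonal (b : HilbertBasis ℕ ℂ H) (T : H →L[ℂ] H) : Prop :=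
  ∃ x : ℕ → ℂ, ∀ n, T (b n) = x n • b n

set_option linter.unusedSectionVars false in
theorem eq_of_inner_basis (b : HilbertBasis ℕ ℂ H) {u v : H}
    (h : ∀ m, inner ℂ (b m) u = inner ℂ (b m) v) : u = v := by
  apply b.repr.injective
  ext m
  rw [b.repr_apply_apply, b.repr_apply_apply, h]

theorem IsDiagonal.star {b : HilbertBasis ℕ ℂ H} {T : H →L[ℂ] H} (hT : IsDiagonal b T) :
    IsDiagonal b (star T) := by
  obtain ⟨x, hx⟩ := hT
  refine ⟨fun n => (starRingEnd ℂ) (x n), fun n => eq_of_inner_basis b fun m => ?_⟩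
  rw [ContinuousLinearMap.star_eq_adjoint, ContinuousLinearMap.adjoint_inner_right, hx,
    inner_smul_left, inner_smul_right]
  have ho := orthonormal_iff_ite.mp b.orthonormal m n
  rw [ho]
  split_ifs with h
  · rw [h]
  · simp

theorem isCompactOperator_star {K : H →L[ℂ] H} (hK : IsCompactOperator K) :
    IsCompactOperator (star K : H →L[ℂ] H) := by
  rw [ContinuousLinearMap.star_eq_adjoint]
  set L : H →L[ℂ] H := ContinuousLinearMap.adjoint K with hL
  have hKL : IsCompactOperator (K * L : H →L[ℂ] H) := hK.comp_clm L
  have htb : TotallyBounded ((K * L : H →L[ℂ] H) '' Metric.closedBall (0 : H) 1) :=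
    (IsCompactOperator.isCompact_closure_image_closedBall (𝕜₁ := ℂ)
      (f := ((K * L : H →L[ℂ] H) : H →ₗ[ℂ] H)) hKL 1).totallyBounded.subset subset_closure
  have goal : TotallyBounded (L '' Metric.closedBall (0 : H) 1) := by
    rw [Metric.totallyBounded_iff]
    intro ε hε
    obtain ⟨t, hts, htf, hcov⟩ :=
      Metric.finite_approx_of_totallyBounded htb (ε ^ 2 / 2) (by positivity)
    have hts' : ∀ y ∈ t, ∃ x, x ∈ Metric.closedBall (0 : H) 1 ∧ (K * L) x = y :=
      fun y hy => hts hy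
    choose! g hg using hts'
    refine ⟨(fun y => L (g y)) '' t, htf.image _, ?_⟩
    rintro _ ⟨x, hx, rfl⟩
    have hx' := hcov ⟨x, hx, rfl⟩
    simp only [Set.mem_iUnion, exists_prop] at hx' ⊢
    obtain ⟨y, hyt, hy⟩ := hx'
    refine ⟨L (g y), ⟨y, hyt, rfl⟩, ?_⟩
    obtain ⟨hgb, hgy⟩ := hg y hyt
    rw [mem_closedBall_zero_iff] at hx hgb
    rw [← hgy, Metric.mem_ball, dist_eq_norm, ← map_sub] at hy
    rw [Metric.mem_ball, dist_eq_norm, ← map_sub]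
    set z := x - g y with hz
    have hz2 : ‖z‖ ≤ 2 := by
      have := norm_sub_le x (g y)
      linarith
    have h1 : ‖L z‖ ^ 2 = RCLike.re (inner ℂ (K (L z)) z) := by
      rw [← ContinuousLinearMap.adjoint_inner_right, ← hL]
      exact norm_sq_eq_re_inner (𝕜 := ℂ) (L z)
    have h2 : RCLike.re (inner ℂ (K (L z)) z) ≤ ‖K (L z)‖ * ‖z‖ := re_inner_le_norm _ _
    have h3 : ‖K (L z)‖ < ε ^ 2 / 2 := hy
    have h4 : ‖L z‖ ^ 2 < ε ^ 2 := by
      have := norm_nonneg (K (L z))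
      nlinarith
    exact lt_of_pow_lt_pow_left₀ 2 hε.le h4
  change IsCompactOperator ((L : H →ₗ[ℂ] H))
  rw [isCompactOperator_iff_isCompact_closure_image_closedBall (L : H →ₗ[ℂ] H) zero_lt_one]
  exact goal.closure.isCompact_of_isClosed isClosed_closure

/-- The algebra `D + K` of all sums of an operator that is diagonal with respect to `b` and a
compact operator, as a unital *-subalgebra of the bounded operators on `H`. -/
def dk (b : HilbertBasis ℕ ℂ H) : StarSubalgebra ℂ (H →L[ℂ] H) where
  carrier := {T | ∃ D K : H →L[ℂ] H, IsDiagonal b D ∧ IsCompactOperator K ∧ T = D + K}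
  mul_mem' := by
    rintro _ _ ⟨D, K, ⟨x, hx⟩, hK, rfl⟩ ⟨D', K', ⟨x', hx'⟩, hK', rfl⟩
    refine ⟨D * D', D * K' + K * (D' + K'), ⟨fun n => x n * x' n, fun n => ?_⟩, ?_, ?_⟩
    · simp [hx, hx', smul_smul, mul_comm]
    · exact (hK'.clm_comp D).add (hK.comp_clm (D' + K'))
    · noncomm_ring
  add_mem' := by
    rintro _ _ ⟨D, K, ⟨x, hx⟩, hK, rfl⟩ ⟨D', K', ⟨x', hx'⟩, hK', rfl⟩
    refine ⟨D + D', K + K', ⟨fun n => x n + x' n, fun n => ?_⟩, hK.add hK', ?_⟩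
    · simp [hx, hx', add_smul]
    · abel
  algebraMap_mem' := by
    intro c
    refine ⟨algebraMap ℂ _ c, 0, ⟨fun _ => c, fun n => ?_⟩, isCompactOperator_zero, by simp⟩
    simp [Algebra.algebraMap_eq_smul_one]
  star_mem' := by
    rintro _ ⟨D, K, hD, hK, rfl⟩
    exact ⟨star D, star K, hD.star, isCompactOperator_star hK, star_add D K⟩

theorem mem_dk {b : HilbertBasis ℕ ℂ H} {T : H →L[ℂ] H} :
    T ∈ dk b ↔ ∃ D K : H →L[ℂ] H, IsDiagonal b D ∧ IsCompactOperator K ∧ T = D + K := Iff.rfl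

/-! ### The automorphisms `θ_X` and `θ_σ` -/

/-- For a unitary operator `u` on `H` such that `Ad(u)` and `Ad(u*)` map `D + K` into itself,
the *-automorphism `T ↦ u T u*` of `D + K`. -/
def ad (b : HilbertBasis ℕ ℂ H) (u : unitary (H →L[ℂ] H))
    (h : ∀ T ∈ dk b, (u : H →L[ℂ] H) * T * star (u : H →L[ℂ] H) ∈ dk b)
    (h' : ∀ T ∈ dk b, star (u : H →L[ℂ] H) * T * (u : H →L[ℂ] H) ∈ dk b) :
    dk b ≃⋆ₐ[ℂ] dk b :=
  StarAlgEquiv.ofAlgEquiv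
    (AlgEquiv.ofAlgHom
      (((Unitary.conjStarAlgAut ℂ (H →L[ℂ] H) u).toAlgEquiv.toAlgHom.comp
        (dk b).toSubalgebra.val).codRestrict (dk b).toSubalgebra fun T => h T T.2)
      (((Unitary.conjStarAlgAut ℂ (H →L[ℂ] H) u).symm.toAlgEquiv.toAlgHom.comp
        (dk b).toSubalgebra.val).codRestrict (dk b).toSubalgebra fun T => h' T T.2)
      (by
        ext1 T
        exact Subtype.ext ((Unitary.conjStarAlgAut ℂ (H →L[ℂ] H) u).apply_symm_apply T.1))
      (by
        ext1 T
        exact Subtype.ext ((Unitary.conjStarAlgAut ℂ (H →L[ℂ] H) u).symm_apply_apply T.1)))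
    fun T => Subtype.ext (map_star (Unitary.conjStarAlgAut ℂ (H →L[ℂ] H) u) T.1)

theorem coe_ad_apply (b : HilbertBasis ℕ ℂ H) (u : unitary (H →L[ℂ] H)) (h) (h') (T : dk b) :
    (ad b u h h' T : H →L[ℂ] H) = (u : H →L[ℂ] H) * T * star (u : H →L[ℂ] H) := rfl

theorem exp_mem_dk (b : HilbertBasis ℕ ℂ H) {K : H →L[ℂ] H} (hK : IsCompactOperator K) :
    NormedSpace.exp K ∈ dk b := by
  have hs := NormedSpace.exp_series_hasSum_exp' (𝕂 := ℂ) K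
  have hs1 := (hasSum_nat_add_iff' 1).mpr hs
  simp only [Finset.range_one, Finset.sum_singleton, Nat.factorial_zero, Nat.cast_one, inv_one,
    pow_zero, one_smul] at hs1
  have hc : IsCompactOperator (NormedSpace.exp K - 1 : H →L[ℂ] H) := by
    refine isCompactOperator_of_tendsto hs1 (Filter.Eventually.of_forall fun s => ?_)
    refine (compactOperator (RingHom.id ℂ) H H).sum_mem fun n _ => ?_
    refine (compactOperator (RingHom.id ℂ) H H).smul_mem _ ?_
    rw [pow_succ']
    exact hK.comp_clm (K ^ n)
  exact ⟨1, NormedSpace.exp K - 1, ⟨fun _ => 1, fun n => by simp⟩, hc, by abel⟩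

/-- The unitary operator `e^{iX}` for a self-adjoint operator `X`. -/
def expUnitary (X : H →L[ℂ] H) (hX : IsSelfAdjoint X) : unitary (H →L[ℂ] H) :=
  selfAdjoint.expUnitary ⟨X, hX⟩

theorem coe_expUnitary (X : H →L[ℂ] H) (hX : IsSelfAdjoint X) :
    (expUnitary X hX : H →L[ℂ] H) = NormedSpace.exp (Complex.I • X) := rfl

theorem expUnitary_mem_dk (b : HilbertBasis ℕ ℂ H) (X : H →L[ℂ] H) (hX : IsSelfAdjoint X)
    (hXc : IsCompactOperator X) : (expUnitary X hX : H →L[ℂ] H) ∈ dk b := by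
  rw [coe_expUnitary]
  exact exp_mem_dk b (hXc.smul Complex.I)

/-- The automorphism `θ_X = Ad(e^{iX})` of `D + K`, for a compact self-adjoint operator `X`. -/
def thetaExp (b : HilbertBasis ℕ ℂ H) (X : H →L[ℂ] H) (hX : IsSelfAdjoint X)
    (hXc : IsCompactOperator X) : dk b ≃⋆ₐ[ℂ] dk b :=
  ad b (expUnitary X hX)
    (fun _ hT => mul_mem (mul_mem (expUnitary_mem_dk b X hX hXc) hT)
      (star_mem (expUnitary_mem_dk b X hX hXc)))
    (fun _ hT => mul_mem (mul_mem (star_mem (expUnitary_mem_dk b X hX hXc)) hT)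
      (expUnitary_mem_dk b X hX hXc))

/-- The basis `b` rearranged by the permutation `σ`. -/
def permBasis (b : HilbertBasis ℕ ℂ H) (σ : Equiv.Perm ℕ) : HilbertBasis ℕ ℂ H :=
  HilbertBasis.mk (v := fun n => b (σ n)) (b.orthonormal.comp σ σ.injective) (by
    have : Set.range (fun n => b (σ n)) = Set.range b := σ.surjective.range_comp b
    rw [this, b.dense_span])

/-- The unitary operator `U_σ` on `H` that maps `∑ ξ n • b n` to `∑ ξ n • b (σ n)`. -/
def permUnitary (b : HilbertBasis ℕ ℂ H) (σ : Equiv.Perm ℕ) : unitary (H →L[ℂ] H) :=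
  Unitary.linearIsometryEquiv.symm (b.repr.trans (permBasis b σ).repr.symm)

theorem permUnitary_apply_basis (b : HilbertBasis ℕ ℂ H) (σ : Equiv.Perm ℕ) (n : ℕ) :
    (permUnitary b σ : H →L[ℂ] H) (b n) = b (σ n) := by
  have h1 : (permUnitary b σ : H →L[ℂ] H) (b n) = (permBasis b σ).repr.symm (b.repr (b n)) := rfl
  have h2 : (permBasis b σ) n = b (σ n) := by simp [permBasis]
  rw [h1, b.repr_self, HilbertBasis.repr_symm_single, h2]

theorem star_permUnitary_apply_basis (b : HilbertBasis ℕ ℂ H) (σ : Equiv.Perm ℕ) (n : ℕ) :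
    (star (permUnitary b σ : H →L[ℂ] H)) (b n) = b (σ.symm n) := by
  have h := permUnitary_apply_basis b σ (σ.symm n)
  rw [Equiv.apply_symm_apply] at h
  rw [← h, ← mul_apply_eq_comp, Unitary.star_mul_self_of_mem (permUnitary b σ).2]
  rfl

/-- The automorphism `θ_σ = Ad(U_σ)` of `D + K`, for a permutation `σ` of the index set. -/
def thetaPerm (b : HilbertBasis ℕ ℂ H) (σ : Equiv.Perm ℕ) : dk b ≃⋆ₐ[ℂ] dk b :=
  ad b (permUnitary b σ)
    (by
      rintro _ ⟨D, K, ⟨x, hx⟩, hK, rfl⟩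
      set U : H →L[ℂ] H := (permUnitary b σ : H →L[ℂ] H) with hU
      refine ⟨U * D * star U, U * K * star U, ⟨fun n => x (σ.symm n), fun n => ?_⟩,
        (hK.clm_comp U).comp_clm (star U), by noncomm_ring⟩
      simp only [mul_apply_eq_comp]
      rw [hU, star_permUnitary_apply_basis, hx, map_smul, permUnitary_apply_basis,
        Equiv.apply_symm_apply])
    (by
      rintro _ ⟨D, K, ⟨x, hx⟩, hK, rfl⟩
      set U : H →L[ℂ] H := (permUnitary b σ : H →L[ℂ] H) with hU
      refine ⟨star U * D * U, star U * K * U, ⟨fun n => x (σ n), fun n => ?_⟩,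
        (hK.clm_comp (star U)).comp_clm U, by noncomm_ring⟩
      simp only [mul_apply_eq_comp]
      rw [hU, permUnitary_apply_basis, hx, map_smul, star_permUnitary_apply_basis,
        Equiv.symm_apply_apply])

/-! ### Nullity and rank -/

/-- The dimension of the null space of `T`, a natural number or `∞`
(`H` is separable here, so this is the Hilbert space dimension). -/
def nullity (T : H →L[ℂ] H) : ℕ∞ :=
  Cardinal.toENat (Module.rank ℂ (LinearMap.ker (T : H →ₗ[ℂ] H)))

/-- The dimension of the range of `T`, a natural number or `∞`
(`H` is separable here, so for closed range this is the Hilbert space dimension). -/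
def rank (T : H →L[ℂ] H) : ℕ∞ :=
  Cardinal.toENat (Module.rank ℂ (LinearMap.range (T : H →ₗ[ℂ] H)))

end

end DiagonalPlusCompact

/-!
Every projection `P` in `D + K` equals `exp (iX) E exp (iX)⋆`, where `X` is compact and self-adjoint
and `E` is the coordinate projection of some set `S` of indices
(`exists_exp_conj_coordProj`). Given this for `P` and for `Q`, with sets `S` and `S'`, the unitary
invariance of nullity and rank shows that `S` and `S'`, and their complements, have the same number
of elements, so some permutation of `ℕ` maps `S` onto `S'`.

To diagonalize `P = D + K`, note that `D² - D` is compact, so the entries of `D` accumulate only at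
`0` and `1`, and rounding them gives a coordinate projection with `P - E` compact
(`exists_coordProj_sub_isCompactOperator`). The spaces `ker P ⊓ range E` and `range P ⊓ ker E` are
then contained in eigenspaces of `P - E` for nonzero eigenvalues, hence finite-dimensional.
Finitely many changes of `S` make both of them zero (`exists_coordProj_generic`): indices are
removed until the first one vanishes, then added until the second one does. This takes the place of a Fredholm index argument.

In this position the product `st` of the symmetries `s = 2P - 1` and `t = 2E - 1` does not have the
eigenvalue `-1`. As `st - 1` is compact, the Fredholm alternative gives `-1 ∉ spectrum (st)`, so that
`st = exp (iZ)` with `Z = arg (st)`, and `Z` is a multiple of `st - 1`, hence compact. Since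
`t (st) t = (st)⋆`, also `t Z t = -Z`; so `u = exp (iZ/2)` satisfies `t u⋆ = u t`, and therefore
`u t u⋆ = u² t = s`, that is, `u E u⋆ = P` (`exists_exp_conj_eq`).
-/

/-! ### Conjugating symmetries of a C⋆-algebra -/

open NormedSpace in
/-- If `s` and `t` are self-adjoint unitaries with `‖s t - 1‖ < 2`, then half of the argument of
`s t` generates a unitary that conjugates `t` to `s`. The factorization of the generator `X` puts it
in every ideal that contains `s t - 1`. -/
theorem exists_exp_conj_eq {A : Type*} [CStarAlgebra A] {s t : A} (hs : IsSelfAdjoint s)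
    (ht : IsSelfAdjoint t) (hss : s * s = 1) (htt : t * t = 1) (h : ‖s * t - 1‖ < 2) :
    ∃ X c : A, IsSelfAdjoint X ∧ X = (s * t - 1) * c ∧
      exp (Complex.I • X) * t * star (exp (Complex.I • X)) = s := by
  let : NormedAlgebra ℚ A := .restrictScalars ℚ ℂ A
  have htu : t ∈ unitary A := by simp [Unitary.mem_iff, ht.star_eq, htt]
  have hsu : s ∈ unitary A := by simp [Unitary.mem_iff, hs.star_eq, hss]
  set v : unitary A := ⟨s * t, mul_mem hsu htu⟩ with hv
  have hvc : (v : A) = s * t := rfl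
  have hslit := (Unitary.spectrum_subset_slitPlane_iff_norm_lt_two v.2).mpr h
  have hstar : star (v : A) = t * s := by simp [hvc, hs.star_eq, ht.star_eq]
  set Z : A := cfc (fun z : ℂ => (Complex.arg z : ℂ)) (v : A) with hZ
  have hZsa : IsSelfAdjoint Z := (Unitary.argSelfAdjoint v).2
  have hexp : exp (Complex.I • Z) = v :=
    congrArg Subtype.val (expUnitary_argSelfAdjoint (u := v) h)
  have hcont : ContinuousOn (fun z : ℂ => (Complex.arg z : ℂ)) (spectrum ℂ (v : A)) :=
    Complex.continuous_ofReal.comp_continuousOn (Complex.continuousOn_arg.mono hslit)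
  -- On the unit circle `arg z = -i log z`, and `log z` is `z - 1` times a continuous function.
  have hzero : ∃ c : A, Z = (s * t - 1) * c := by
    have hg : ContinuousOn (dslope Complex.log 1) Complex.slitPlane := by
      rw [continuousOn_dslope (Complex.isOpen_slitPlane.mem_nhds Complex.one_mem_slitPlane)]
      exact ⟨continuousOn_id.clog fun x hx => hx,
        (Complex.hasStrictDerivAt_log Complex.one_mem_slitPlane).hasDerivAt.differentiableAt⟩
    have hg' : ContinuousOn (fun z => -Complex.I * dslope Complex.log 1 z)
        (spectrum ℂ (v : A)) := continuousOn_const.mul (hg.mono hslit)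
    refine ⟨cfc (fun z => -Complex.I * dslope Complex.log 1 z) (v : A), ?_⟩
    have h1 : (s * t - 1 : A) = cfc (fun z : ℂ => z - 1) (v : A) := by
      rw [cfc_sub .., cfc_id' .., cfc_const_one .., hvc]
    rw [h1, ← cfc_mul (fun z : ℂ => z - 1) _ (v : A), hZ]
    refine cfc_congr fun z hz => ?_
    have hz1 : ‖z‖ = 1 := spectrum.norm_eq_one_of_unitary v.2 hz
    have hlog : Complex.log z = Complex.I * z.arg :=
      Complex.ext (by simp [Complex.log_re, hz1]) (by simp [Complex.log_im])
    have := sub_smul_dslope Complex.log 1 z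
    rw [smul_eq_mul, Complex.log_one, sub_zero, hlog] at this
    calc (z.arg : ℂ) = -Complex.I * (Complex.I * z.arg) := by
          rw [← mul_assoc]; simp
      _ = _ := by rw [← this]; ring
  -- Conjugation by `t` maps `s t` to its adjoint, and `arg` is odd under complex conjugation
  -- away from the negative half-line.
  have hconj : t * Z * t = -Z := by
    have h1 := StarAlgHomClass.map_cfc (Unitary.conjStarAlgAut ℂ A ⟨t, htu⟩)
      (fun z : ℂ => (Complex.arg z : ℂ)) (v : A) hcont
      (by
        have : (⇑(Unitary.conjStarAlgAut ℂ A ⟨t, htu⟩) : A → A) = fun x => t * x * star t := rfl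
        rw [this]; fun_prop)
    have h2 : (Unitary.conjStarAlgAut ℂ A ⟨t, htu⟩) (v : A) = star (v : A) := by
      rw [Unitary.conjStarAlgAut_apply, hstar]
      simp only [ht.star_eq, hvc, mul_assoc, htt, mul_one]
    rw [h2, Unitary.conjStarAlgAut_apply, ← hZ] at h1
    simp only [ht.star_eq] at h1
    rw [h1, hZ, ← cfc_neg, ← cfc_comp_star (fun z : ℂ => (Complex.arg z : ℂ)) (v : A) ?_]
    · refine cfc_congr fun z hz => ?_
      have : z.arg ≠ Real.pi := (Complex.mem_slitPlane_iff_arg.mp (hslit hz)).1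
      simp [Complex.arg_conj, this]
    · refine Complex.continuous_ofReal.comp_continuousOn (Complex.continuousOn_arg.mono ?_)
      rintro _ ⟨z, hz, rfl⟩
      rcases hslit hz with h | h
      · exact Or.inl (by simpa using h)
      · exact Or.inr (by simpa using h)
  obtain ⟨c, hc⟩ := hzero
  have hX : IsSelfAdjoint ((2⁻¹ : ℝ) • Z) := (IsSelfAdjoint.all _).smul hZsa
  refine ⟨(2⁻¹ : ℝ) • Z, (2⁻¹ : ℝ) • c, hX, by rw [hc, mul_smul_comm], ?_⟩
  set u := exp (Complex.I • (2⁻¹ : ℝ) • Z) with hu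
  have hus : star u = exp (-(Complex.I • (2⁻¹ : ℝ) • Z)) := by
    rw [hu, star_exp, star_smul, hX.star_eq]; simp
  have hinv : t * star u = u * t := by
    have : t * star u * t = u := by
      have h1 := exp_units_conj (⟨t, t, htt, htt⟩ : Aˣ) (-(Complex.I • (2⁻¹ : ℝ) • Z))
      rw [hus]
      refine h1.symm.trans ?_
      rw [hu]
      congr 1
      change t * _ * t = _
      rw [mul_neg, neg_mul, mul_smul_comm, smul_mul_assoc, mul_smul_comm, smul_mul_assoc, hconj]
      simp
    conv_rhs => rw [← this]
    simp only [mul_assoc, htt, mul_one]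
  have huu : u * u = s * t := by
    rw [← hvc, ← hexp, hu, ← exp_add_of_commute (Commute.refl _), ← smul_add, ← add_smul]
    norm_num
  rw [mul_assoc, hinv, ← mul_assoc, huu, mul_assoc, htt, mul_one]

open Filter Topology

namespace DiagonalPlusCompact

set_option linter.unusedSectionVars false

variable {H : Type*} [NormedAddCommGroup H] [InnerProductSpace ℂ H] [CompleteSpace H]

/-! ### Coordinate projections and diagonal operators -/

theorem ext_hilbertBasis (b : HilbertBasis ℕ ℂ H) {T T' : H →L[ℂ] H}
    (h : ∀ n, T (b n) = T' (b n)) : T = T' :=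
  ContinuousLinearMap.ext_on
    (Submodule.dense_iff_topologicalClosure_eq_top.mpr b.dense_span)
    (by rintro _ ⟨n, rfl⟩; exact h n)

theorem inner_basis (b : HilbertBasis ℕ ℂ H) (m n : ℕ) :
    inner ℂ (b m) (b n) = if m = n then 1 else 0 :=
  orthonormal_iff_ite.mp b.orthonormal m n

/-- The vectors whose coordinates outside `S` vanish. They are introduced as an orthogonal
complement, which makes the subspace visibly closed. -/
noncomputable def coordSubspace (b : HilbertBasis ℕ ℂ H) (S : Set ℕ) : Submodule ℂ H :=
  (Submodule.span ℂ (b '' Sᶜ))ᗮ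

theorem mem_coordSubspace {b : HilbertBasis ℕ ℂ H} {S : Set ℕ} {v : H} :
    v ∈ coordSubspace b S ↔ ∀ n ∉ S, inner ℂ (b n) v = 0 := by
  rw [coordSubspace, Submodule.mem_orthogonal]
  refine ⟨fun h n hn => h _ (Submodule.subset_span ⟨n, hn, rfl⟩), fun h u hu => ?_⟩
  induction hu using Submodule.span_induction with
  | mem x hx => obtain ⟨n, hn, rfl⟩ := hx; exact h n hn
  | zero => simp
  | add x y _ _ hx hy => rw [inner_add_left, hx, hy, add_zero]
  | smul a x _ hx => rw [inner_smul_left, hx, mul_zero]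

theorem basis_mem_coordSubspace (b : HilbertBasis ℕ ℂ H) {S : Set ℕ} {n : ℕ} (hn : n ∈ S) :
    b n ∈ coordSubspace b S :=
  mem_coordSubspace.mpr fun m hm => by
    rw [inner_basis, if_neg (by rintro rfl; exact hm hn)]

instance completeSpace_coordSubspace (b : HilbertBasis ℕ ℂ H) (S : Set ℕ) :
    CompleteSpace (coordSubspace b S) :=
  inferInstanceAs (CompleteSpace (Submodule.span ℂ (b '' Sᶜ))ᗮ)

theorem orthogonal_coordSubspace (b : HilbertBasis ℕ ℂ H) (S : Set ℕ) :
    (coordSubspace b S)ᗮ = coordSubspace b Sᶜ := by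
  ext v
  rw [mem_coordSubspace, Submodule.mem_orthogonal]
  refine ⟨fun h n hn => h _ (basis_mem_coordSubspace b (not_not.mp hn)), fun h u hu => ?_⟩
  rw [mem_coordSubspace] at hu
  rw [← b.tsum_inner_mul_inner u v]
  refine (tsum_congr fun n => ?_).trans tsum_zero
  by_cases hn : n ∈ S
  · rw [h n (not_not.mpr hn), mul_zero]
  · rw [← inner_conj_symm, hu n hn, map_zero, zero_mul]

/-- The orthogonal projection onto the closed span of the basis vectors with index in `S`. -/
noncomputable def coordProj (b : HilbertBasis ℕ ℂ H) (S : Set ℕ) : H →L[ℂ] H :=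
  (coordSubspace b S).starProjection

open Classical in
theorem coordProj_apply_basis (b : HilbertBasis ℕ ℂ H) (S : Set ℕ) (n : ℕ) :
    coordProj b S (b n) = (if n ∈ S then 1 else 0 : ℂ) • b n := by
  split_ifs with h
  · rw [one_smul]
    exact Submodule.starProjection_eq_self_iff.mpr (basis_mem_coordSubspace b h)
  · rw [zero_smul, coordProj, Submodule.starProjection_apply_eq_zero_iff, orthogonal_coordSubspace]
    exact basis_mem_coordSubspace b h

/-- A diagonal operator is multiplication by its entries in the coordinates. -/
theorem inner_apply_of_diagonal {b : HilbertBasis ℕ ℂ H} {T : H →L[ℂ] H} {x : ℕ → ℂ}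
    (hT : ∀ n, T (b n) = x n • b n) (n : ℕ) (v : H) :
    inner ℂ (b n) (T v) = x n * inner ℂ (b n) v := by
  have key : (innerSL ℂ (b n)).comp T = x n • innerSL ℂ (b n) := by
    refine ContinuousLinearMap.ext_on
      (Submodule.dense_iff_topologicalClosure_eq_top.mpr b.dense_span) ?_
    rintro _ ⟨m, rfl⟩
    simp only [ContinuousLinearMap.comp_apply, hT, smul_apply, innerSL_apply_apply,
      inner_smul_right, inner_basis, smul_eq_mul]
    split_ifs with h <;> simp [h]
  exact congrArg (fun f => f v) key

theorem norm_le_of_diagonal {b : HilbertBasis ℕ ℂ H} {T : H →L[ℂ] H} {x : ℕ → ℂ}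
    (hT : ∀ n, T (b n) = x n • b n) {ε : ℝ} (hε : 0 ≤ ε) (hx : ∀ n, ‖x n‖ ≤ ε) : ‖T‖ ≤ ε := by
  refine T.opNorm_le_bound hε fun v => ?_
  have hsq (w : H) : HasSum (fun n => ‖(inner ℂ (b n) w : ℂ)‖ ^ 2) (‖w‖ ^ 2) := by
    have h := lp.hasSum_norm (p := 2) (by norm_num) (b.repr w)
    simpa [b.repr_apply_apply] using h
  refine le_of_sq_le_sq ?_ (by positivity)
  rw [mul_pow]
  refine hasSum_le (fun n => ?_) (hsq (T v)) ((hsq v).mul_left (ε ^ 2))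
  rw [inner_apply_of_diagonal hT, norm_mul, mul_pow]
  gcongr
  exact hx n

/-- A diagonal operator whose entries tend to zero is a norm limit of finite rank operators. -/
theorem isCompactOperator_of_diagonal {b : HilbertBasis ℕ ℂ H} {T : H →L[ℂ] H} {x : ℕ → ℂ}
    (hT : ∀ n, T (b n) = x n • b n) (hx : Tendsto x atTop (𝓝 0)) : IsCompactOperator T := by
  set F : ℕ → H →L[ℂ] H := fun N =>
    ∑ n ∈ Finset.range N, x n • InnerProductSpace.rankOne ℂ (b n) (b n)
  have hF : ∀ N, IsCompactOperator (F N) := fun N => by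
    refine (compactOperator (RingHom.id ℂ) H H).sum_mem fun n _ => ?_
    refine (compactOperator (RingHom.id ℂ) H H).smul_mem _ ?_
    exact (isCompactOperator_of_locallyCompactSpace_rng
      (ContinuousLinearMap.toSpanSingleton ℂ (b n))).comp_clm (innerSL ℂ (b n))
  refine isCompactOperator_of_tendsto (F := F) (l := atTop) ?_ (Eventually.of_forall hF)
  rw [Metric.tendsto_atTop]
  intro ε hε
  obtain ⟨N, hN⟩ := Metric.tendsto_atTop.mp hx (ε / 2) (by positivity)
  refine ⟨N, fun M hM => ?_⟩
  rw [dist_comm, dist_eq_norm]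
  refine (norm_le_of_diagonal (b := b) (x := fun n => if n < M then 0 else x n) (ε := ε / 2)
    (fun n => ?_) (by positivity) fun n => ?_).trans_lt (by linarith)
  · have hrank (k : ℕ) : InnerProductSpace.rankOne ℂ (b k) (b k) (b n) =
        if k = n then b k else 0 := by
      rw [InnerProductSpace.rankOne_apply, inner_basis]
      split_ifs <;> simp
    have hFn : F M (b n) = if n < M then x n • b n else 0 := by
      simp [F, hrank]
    rw [sub_apply, hT, hFn]
    split_ifs <;> simp
  · split_ifs with h
    · simpa using (half_pos hε).le
    · simpa using (hN n (by omega)).le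

/-- The entries of a compact diagonal operator tend to zero. -/
theorem tendsto_entries_of_isCompactOperator {b : HilbertBasis ℕ ℂ H} {T : H →L[ℂ] H} {x : ℕ → ℂ}
    (hT : ∀ n, T (b n) = x n • b n) (hc : IsCompactOperator T) : Tendsto x atTop (𝓝 0) := by
  obtain ⟨C, hC, hC'⟩ := hc.image_closedBall_subset_compact 1
  have hmem : ∀ n, T (b n) ∈ C := fun n => hC' ⟨b n, by simp [b.orthonormal.1 n], rfl⟩
  refine tendsto_of_subseq_tendsto fun ns hns => ?_
  obtain ⟨z, -, φ, hφ, hz⟩ := hC.tendsto_subseq fun k => hmem (ns k)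
  have hnsφ := hns.comp hφ.tendsto_atTop
  -- All coordinates of the limit vanish, as `T (b n)` has no coordinate `m` for `n > m`.
  have hz0 : z = 0 := by
    refine eq_of_inner_basis b fun m => ?_
    have h1 : Tendsto (fun k => inner ℂ (b m) (T (b (ns (φ k))))) atTop (𝓝 (inner ℂ (b m) z)) :=
      ((innerSL ℂ (b m)).continuous.tendsto z).comp hz
    rw [inner_zero_right]
    refine tendsto_nhds_unique h1 (tendsto_const_nhds.congr' ?_)
    filter_upwards [hnsφ.eventually_gt_atTop m] with k hk
    have : m ≠ ns (φ k) := hk.ne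
    simp [hT, inner_basis, this]
  refine ⟨φ, ?_⟩
  -- `‖x n‖ = ‖T (b n)‖`, as the basis vectors are unit vectors.
  rw [tendsto_zero_iff_norm_tendsto_zero]
  have := hz.norm
  rw [hz0, norm_zero] at this
  refine this.congr fun k => ?_
  simp [hT, norm_smul, b.orthonormal.1]

/-- The diagonal part of an idempotent in `D + K` is idempotent modulo the compact operators, so its
entries accumulate only at `0` and `1`. Rounding them gives the coordinate projection. -/
theorem exists_coordProj_sub_isCompactOperator {b : HilbertBasis ℕ ℂ H} {P : H →L[ℂ] H}
    (hP : P ∈ dk b) (hid : P * P = P) : ∃ S : Set ℕ, IsCompactOperator (P - coordProj b S) := by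
  obtain ⟨D, K, ⟨x, hx⟩, hK, rfl⟩ := hP
  have hcomp : IsCompactOperator (D * D - D : H →L[ℂ] H) := by
    have : D * D - D = K - D * K - K * (D + K) := by
      have : D * D = (D + K) * (D + K) - D * K - K * (D + K) := by noncomm_ring
      rw [this, hid]; abel
    rw [this]
    exact (hK.sub (hK.clm_comp D)).sub (hK.comp_clm (D + K))
  have hlim := tendsto_entries_of_isCompactOperator (b := b) (x := fun n => x n * (x n - 1))
    (fun n => by simp [hx, smul_smul, mul_sub, sub_smul]) hcomp
  refine ⟨{n | ‖x n - 1‖ ≤ ‖x n‖}, ?_⟩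
  set S : Set ℕ := {n | ‖x n - 1‖ ≤ ‖x n‖}
  classical
  have hDE : IsCompactOperator (D - coordProj b S) := by
    refine isCompactOperator_of_diagonal (b := b)
      (x := fun n => x n - if n ∈ S then 1 else 0) (fun n => ?_) ?_
    · rw [sub_smul, ← hx, ← coordProj_apply_basis, sub_apply]
    · have h2 := (tendsto_zero_iff_norm_tendsto_zero.mp hlim).const_mul 2
      rw [mul_zero] at h2
      refine squeeze_zero_norm (fun n => ?_) h2
      have htri : (1 : ℝ) ≤ ‖x n‖ + ‖x n - 1‖ := by
        have := norm_sub_le (x n) (x n - 1)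
        simpa using this
      have h0 := norm_nonneg (x n)
      have h1 := norm_nonneg (x n - 1)
      rw [norm_mul]
      split_ifs with h
      · have : ‖x n - 1‖ ≤ ‖x n‖ := h
        nlinarith
      · have : ‖x n‖ < ‖x n - 1‖ := not_le.mp h
        rw [sub_zero]
        nlinarith
  rw [add_sub_right_comm]
  exact hDE.add hK

/-! ### Coordinate subspaces in general position -/

theorem coordSubspace_mono (b : HilbertBasis ℕ ℂ H) {S S' : Set ℕ} (h : S ⊆ S') :
    coordSubspace b S ≤ coordSubspace b S' :=
  fun _ hv => mem_coordSubspace.mpr fun n hn => mem_coordSubspace.mp hv n fun hS => hn (h hS)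

/-- A nonzero vector in the coordinate subspace of `S` has a nonzero coordinate in `S`. -/
theorem exists_inner_basis_ne_zero {b : HilbertBasis ℕ ℂ H} {S : Set ℕ} {v : H}
    (hv : v ∈ coordSubspace b S) (hv0 : v ≠ 0) : ∃ n ∈ S, inner ℂ (b n) v ≠ 0 := by
  by_contra! h
  refine hv0 (eq_of_inner_basis b fun n => ?_)
  rw [inner_zero_right]
  by_cases hn : n ∈ S
  · exact h n hn
  · exact mem_coordSubspace.mp hv n hn

/-- A finite-dimensional intersection with a coordinate subspace becomes trivial after finitely many
indices are removed: removing an index at which some vector of the intersection does not vanish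
lowers the dimension. -/
theorem exists_inf_coordSubspace_eq_bot (b : HilbertBasis ℕ ℂ H) (W : Submodule ℂ H) (S : Set ℕ)
    [FiniteDimensional ℂ (W ⊓ coordSubspace b S : Submodule ℂ H)] :
    ∃ S' : Set ℕ, (∀ᶠ n in atTop, n ∈ S' ↔ n ∈ S) ∧ W ⊓ coordSubspace b S' = ⊥ := by
  induction h : Module.finrank ℂ (W ⊓ coordSubspace b S : Submodule ℂ H)
    using Nat.strong_induction_on generalizing S with
  | _ k ih =>
    by_cases hbot : W ⊓ coordSubspace b S = ⊥
    · exact ⟨S, Eventually.of_forall fun _ => Iff.rfl, hbot⟩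
    obtain ⟨v, ⟨hvW, hvS⟩, hv0⟩ := Submodule.exists_mem_ne_zero_of_ne_bot hbot
    obtain ⟨n, hnS, hn⟩ := exists_inner_basis_ne_zero hvS hv0
    have hle : W ⊓ coordSubspace b (S \ {n}) ≤ W ⊓ coordSubspace b S :=
      inf_le_inf_left W (coordSubspace_mono b Set.sdiff_subset)
    have hlt : W ⊓ coordSubspace b (S \ {n}) < W ⊓ coordSubspace b S :=
      lt_of_le_not_ge hle fun hge =>
        hn (mem_coordSubspace.mp (hge ⟨hvW, hvS⟩).2 n (by simp))
    have := Submodule.finiteDimensional_of_le hle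
    obtain ⟨S', hS', hS'bot⟩ :=
      ih _ (h ▸ Submodule.finrank_lt_finrank_of_lt hlt) (S \ {n}) rfl
    refine ⟨S', ?_, hS'bot⟩
    filter_upwards [hS', eventually_ne_atTop n] with m hm hmn
    simp [hm, hmn]

/-- If `w ∈ U` has no coordinates in `S` but a nonzero coordinate at `n`, then adding `n` to `S`
lowers the dimension of `U ⊓ coordSubspace b Sᶜ`. It keeps `Uᗮ ⊓ coordSubspace b S` trivial, because
a vector of `Uᗮ` supported in `insert n S` is orthogonal to `w`, and hence supported in `S`. -/
theorem exists_inf_coordSubspace_compl_eq_bot (b : HilbertBasis ℕ ℂ H) (U : Submodule ℂ H)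
    (S : Set ℕ) (hS : Uᗮ ⊓ coordSubspace b S = ⊥)
    [FiniteDimensional ℂ (U ⊓ coordSubspace b Sᶜ : Submodule ℂ H)] :
    ∃ S' : Set ℕ, (∀ᶠ n in atTop, n ∈ S' ↔ n ∈ S) ∧ Uᗮ ⊓ coordSubspace b S' = ⊥ ∧
      U ⊓ coordSubspace b S'ᶜ = ⊥ := by
  induction h : Module.finrank ℂ (U ⊓ coordSubspace b Sᶜ : Submodule ℂ H)
    using Nat.strong_induction_on generalizing S with
  | _ k ih =>
    by_cases hbot : U ⊓ coordSubspace b Sᶜ = ⊥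
    · exact ⟨S, Eventually.of_forall fun _ => Iff.rfl, hS, hbot⟩
    obtain ⟨w, ⟨hwU, hwS⟩, hw0⟩ := Submodule.exists_mem_ne_zero_of_ne_bot hbot
    obtain ⟨n, hnS, hn⟩ := exists_inner_basis_ne_zero hwS hw0
    have hle : U ⊓ coordSubspace b (insert n S)ᶜ ≤ U ⊓ coordSubspace b Sᶜ :=
      inf_le_inf_left U (coordSubspace_mono b (Set.compl_subset_compl.mpr (Set.subset_insert n S)))
    have hlt : U ⊓ coordSubspace b (insert n S)ᶜ < U ⊓ coordSubspace b Sᶜ :=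
      lt_of_le_not_ge hle fun hge =>
        hn (mem_coordSubspace.mp (hge ⟨hwU, hwS⟩).2 n (by simp))
    have := Submodule.finiteDimensional_of_le hle
    have hins : Uᗮ ⊓ coordSubspace b (insert n S) = ⊥ := by
      rw [Submodule.eq_bot_iff]
      rintro v ⟨hvU, hvS⟩
      -- The only index at which both `w` and `v` can have a nonzero coordinate is `n`.
      have hvn : inner ℂ (b n) v = 0 := by
        have h0 : inner ℂ w v = 0 := Submodule.inner_right_of_mem_orthogonal hwU hvU
        rw [← b.tsum_inner_mul_inner w v, tsum_eq_single n] at h0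
        · refine (mul_eq_zero.mp h0).resolve_left fun h => hn ?_
          rw [← inner_conj_symm, h, map_zero]
        · intro m hmn
          by_cases hm : m ∈ S
          · rw [← inner_conj_symm, mem_coordSubspace.mp hwS m (not_not.mpr hm), map_zero, zero_mul]
          · rw [mem_coordSubspace.mp hvS m (by simp [hm, hmn]), mul_zero]
      have : v ∈ Uᗮ ⊓ coordSubspace b S := by
        refine ⟨hvU, mem_coordSubspace.mpr fun m hm => ?_⟩
        by_cases hmn : m = n
        · rw [hmn, hvn]
        · exact mem_coordSubspace.mp hvS m (by simp [hm, hmn])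
      rwa [hS, Submodule.mem_bot] at this
    obtain ⟨S', hS', h1, h2⟩ :=
      ih _ (h ▸ Submodule.finrank_lt_finrank_of_lt hlt) (insert n S) hins rfl
    refine ⟨S', ?_, h1, h2⟩
    filter_upwards [hS', eventually_ne_atTop n] with m hm hmn
    simp [hm, hmn]

/-- Changing finitely many indices changes a coordinate projection by a compact operator. -/
theorem isCompactOperator_coordProj_sub (b : HilbertBasis ℕ ℂ H) {S S' : Set ℕ}
    (h : ∀ᶠ n in atTop, n ∈ S' ↔ n ∈ S) :
    IsCompactOperator (coordProj b S - coordProj b S') := by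
  classical
  refine isCompactOperator_of_diagonal (b := b)
    (x := fun n => (if n ∈ S then 1 else 0) - (if n ∈ S' then 1 else 0)) (fun n => ?_) ?_
  · rw [sub_apply, coordProj_apply_basis, coordProj_apply_basis, sub_smul]
  · refine tendsto_const_nhds.congr' ?_
    filter_upwards [h] with n hn
    simp [hn]

theorem finiteDimensional_of_isCompactOperator {A : H →L[ℂ] H} (hA : IsCompactOperator A)
    {μ : ℂ} (hμ : μ ≠ 0) {W : Submodule ℂ H} (hW : ∀ v ∈ W, A v = μ • v) :
    FiniteDimensional ℂ W := by
  have := ContinuousLinearMap.finite_dimensional_eigenspace hA μ hμ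
  exact Submodule.finiteDimensional_of_le (S₂ := Module.End.eigenspace A.toLinearMap μ)
    fun v hv => Module.End.mem_eigenspace_iff.mpr (hW v hv)

/-- If the projection onto `U` is a compact perturbation of a coordinate projection, then the
coordinate projection can be chosen in general position with respect to `U`. -/
theorem exists_coordProj_generic (b : HilbertBasis ℕ ℂ H) (U : Submodule ℂ H)
    [U.HasOrthogonalProjection] {S : Set ℕ}
    (hS : IsCompactOperator (U.starProjection - coordProj b S)) :
    ∃ S' : Set ℕ, IsCompactOperator (U.starProjection - coordProj b S') ∧
      Uᗮ ⊓ coordSubspace b S' = ⊥ ∧ U ⊓ coordSubspace b S'ᶜ = ⊥ := by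
  have hcomp {S' S'' : Set ℕ} (h : IsCompactOperator (U.starProjection - coordProj b S'))
      (h' : ∀ᶠ n in atTop, n ∈ S'' ↔ n ∈ S') :
      IsCompactOperator (U.starProjection - coordProj b S'') := by
    rw [← sub_add_sub_cancel _ (coordProj b S')]
    exact h.add (isCompactOperator_coordProj_sub b h')
  -- On this intersection the compact operator `P - E` is `-1`.
  have : FiniteDimensional ℂ (Uᗮ ⊓ coordSubspace b S : Submodule ℂ H) := by
    refine finiteDimensional_of_isCompactOperator hS (μ := -1) (by simp) fun v hv => ?_
    rw [sub_apply, U.starProjection_apply_eq_zero_iff.mpr hv.1, coordProj,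
      Submodule.starProjection_eq_self_iff.mpr hv.2]
    simp
  obtain ⟨S₁, h₁, h₁bot⟩ := exists_inf_coordSubspace_eq_bot b Uᗮ S
  -- On this intersection the compact operator `P - E` is `1`.
  have : FiniteDimensional ℂ (U ⊓ coordSubspace b S₁ᶜ : Submodule ℂ H) := by
    refine finiteDimensional_of_isCompactOperator (hcomp hS h₁) (μ := 1) (by simp) fun v hv => ?_
    have h2 := hv.2
    rw [SetLike.mem_coe, ← orthogonal_coordSubspace] at h2
    rw [sub_apply, Submodule.starProjection_eq_self_iff.mpr hv.1, coordProj,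
      Submodule.starProjection_apply_eq_zero_iff _ |>.mpr h2]
    simp
  obtain ⟨S₂, h₂, h₂bot, h₂bot'⟩ := exists_inf_coordSubspace_compl_eq_bot b U S₁ h₁bot
  exact ⟨S₂, hcomp (hcomp hS h₁) h₂, h₂bot, h₂bot'⟩

/-! ### Unitary equivalence of projections with compact difference -/

/-- The product of the symmetries of two subspaces in general position is not at distance `2` from
`1`: an eigenvector `x` for the eigenvalue `-1` satisfies `P x + E x = x`, which puts `E x` in
`Uᗮ ⊓ V` and `P x` in `U ⊓ Vᗮ`, and the Fredholm alternative excludes other spectrum at `-1`. -/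
theorem norm_symm_mul_symm_sub_one_lt_two {U V : Submodule ℂ H} [U.HasOrthogonalProjection]
    [V.HasOrthogonalProjection] (h : Uᗮ ⊓ V = ⊥) (h' : U ⊓ Vᗮ = ⊥)
    (hu : (2 * U.starProjection - 1) * (2 * V.starProjection - 1) ∈ unitary (H →L[ℂ] H))
    (hc : IsCompactOperator
      ((2 * U.starProjection - 1) * (2 * V.starProjection - 1) - 1 : H →L[ℂ] H)) :
    ‖(2 * U.starProjection - 1) * (2 * V.starProjection - 1) - 1‖ < 2 := by
  rw [Unitary.norm_sub_one_lt_two_iff hu]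
  set P := U.starProjection with hP
  set E := V.starProjection with hE
  intro hspec
  have hspec' : (-2 : ℂ) ∈ spectrum ℂ ((2 * P - 1) * (2 * E - 1) - 1) := by
    have := (spectrum.add_mem_add_iff (R := ℂ) (r := -2) (s := 1)
      (a := (2 * P - 1) * (2 * E - 1) - 1)).mp
    rw [map_one, add_sub_cancel] at this
    exact this (by norm_num; exact hspec)
  obtain ⟨x, hx, hx0⟩ :=
    ((hc.hasEigenvalue_iff_mem_spectrum (by norm_num)).mpr hspec').exists_hasEigenvector
  rw [Module.End.mem_eigenspace_iff] at hx
  have hPP : P * P = P := U.isIdempotentElem_starProjection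
  have hss : (2 * P - 1) * (2 * P - 1) = 1 := by
    have : (2 * P - 1) * (2 * P - 1) = 4 * (P * P) - 4 * P + 1 := by noncomm_ring
    rw [this, hPP]; simp
  have hx1 : ((2 * P - 1) * (2 * E - 1)) x = - x := by
    have h1 : ((2 * P - 1) * (2 * E - 1)) x - x = (-2 : ℂ) • x := hx
    rw [sub_eq_iff_eq_add] at h1
    rw [h1]; module
  have hx2 : (2 * E - 1 : H →L[ℂ] H) x = - (2 * P - 1 : H →L[ℂ] H) x := by
    have := congrArg (2 * P - 1 : H →L[ℂ] H) hx1
    rw [← mul_apply_eq_comp, ← mul_assoc, hss, one_mul, map_neg] at this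
    exact this
  have hsum : P x + E x = x := by
    have h1 : (2 : ℂ) • E x - x = - ((2 : ℂ) • P x - x) := by
      have e (T : H →L[ℂ] H) : (2 * T - 1 : H →L[ℂ] H) x = (2 : ℂ) • T x - x := by
        rw [two_mul, two_smul]; rfl
      rw [← e, ← e]; exact hx2
    have h2 : (2 : ℂ) • (P x + E x) = (2 : ℂ) • x := by
      rw [smul_add, eq_comm, two_smul ℂ x, ← sub_eq_zero]
      rw [← sub_eq_zero] at h1
      rw [← neg_eq_zero, ← h1]; abel
    exact smul_right_injective H (two_ne_zero (α := ℂ)) h2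
  have hEP : E x = 0 := by
    have : E x ∈ Uᗮ ⊓ V := by
      refine ⟨?_, V.starProjection_apply_mem x⟩
      rw [eq_sub_iff_add_eq'.mpr hsum]
      exact U.sub_starProjection_mem_orthogonal x
    rwa [h, Submodule.mem_bot] at this
  have hPE : P x = 0 := by
    have : P x ∈ U ⊓ Vᗮ := by
      refine ⟨U.starProjection_apply_mem x, ?_⟩
      rw [eq_sub_iff_add_eq.mpr hsum]
      exact V.sub_starProjection_mem_orthogonal x
    rwa [h', Submodule.mem_bot] at this
  exact hx0 (by rw [← hsum, hEP, hPE, add_zero])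

/-- Projections in general position with compact difference are conjugate by `exp (i X)`, for a
compact self-adjoint operator `X`. -/
theorem exists_exp_conj_starProjection {U V : Submodule ℂ H} [U.HasOrthogonalProjection]
    [V.HasOrthogonalProjection] (h : Uᗮ ⊓ V = ⊥) (h' : U ⊓ Vᗮ = ⊥)
    (hc : IsCompactOperator (U.starProjection - V.starProjection : H →L[ℂ] H)) :
    ∃ X : H →L[ℂ] H, IsSelfAdjoint X ∧ IsCompactOperator X ∧
      NormedSpace.exp (Complex.I • X) * V.starProjection *
        star (NormedSpace.exp (Complex.I • X)) = U.starProjection := by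
  have hsa (W : Submodule ℂ H) [W.HasOrthogonalProjection] :
      IsSelfAdjoint (2 * W.starProjection - 1) := by
    rw [two_mul]
    exact ((isSelfAdjoint_starProjection W).add (isSelfAdjoint_starProjection W)).sub (.one _)
  have hsq (W : Submodule ℂ H) [W.HasOrthogonalProjection] :
      (2 * W.starProjection - 1) * (2 * W.starProjection - 1) = 1 := by
    have h1 : (2 * W.starProjection - 1) * (2 * W.starProjection - 1)
      = 4 * (W.starProjection * W.starProjection) - 4 * W.starProjection + 1 := by noncomm_ring
    have h2 : W.starProjection * W.starProjection = W.starProjection :=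
      W.isIdempotentElem_starProjection
    rw [h1, h2]; simp
  have hunit (W : Submodule ℂ H) [W.HasOrthogonalProjection] :
      2 * W.starProjection - 1 ∈ unitary (H →L[ℂ] H) := by
    rw [Unitary.mem_iff, (hsa W).star_eq]
    exact ⟨hsq W, hsq W⟩
  have hdiff : IsCompactOperator
      ((2 * U.starProjection - 1) * (2 * V.starProjection - 1) - 1 : H →L[ℂ] H) := by
    have : (2 * U.starProjection - 1) * (2 * V.starProjection - 1) - 1
        = (U.starProjection - V.starProjection) * (2 * (2 * V.starProjection - 1)) := by
      nth_rw 3 [← hsq V]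
      noncomm_ring
    rw [this]
    exact hc.comp_clm _
  obtain ⟨X, c, hX, hXc, hexp⟩ := exists_exp_conj_eq (hsa U) (hsa V) (hsq U) (hsq V)
    (norm_symm_mul_symm_sub_one_lt_two h h' (mul_mem (hunit U) (hunit V)) hdiff)
  refine ⟨X, hX, ?_, ?_⟩
  · rw [hXc]
    exact hdiff.comp_clm c
  · set u := NormedSpace.exp (Complex.I • X)
    have huu : u * star u = 1 := Unitary.mul_star_self_of_mem (expUnitary X hX).2
    have h2 : u * (2 * V.starProjection - 1) * star u
        = 2 * (u * V.starProjection * star u) - u * star u := by noncomm_ring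
    rw [h2, huu, sub_left_inj] at hexp
    simpa [two_mul, ← two_smul ℂ] using hexp

/-- Every projection in `D + K` is conjugate to a coordinate projection by `exp (i X)`, for a
compact self-adjoint operator `X`. -/
theorem exists_exp_conj_coordProj (b : HilbertBasis ℕ ℂ H) {P : H →L[ℂ] H} (hP : P ∈ dk b)
    (hproj : IsStarProjection P) :
    ∃ (S : Set ℕ) (X : H →L[ℂ] H), IsSelfAdjoint X ∧ IsCompactOperator X ∧
      NormedSpace.exp (Complex.I • X) * coordProj b S *
        star (NormedSpace.exp (Complex.I • X)) = P := by
  obtain ⟨S, hS⟩ := exists_coordProj_sub_isCompactOperator hP hproj.isIdempotentElem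
  obtain ⟨U, _, rfl⟩ := isStarProjection_iff_eq_starProjection.mp hproj
  obtain ⟨S', hc, h, h'⟩ := exists_coordProj_generic b U hS
  rw [← orthogonal_coordSubspace] at h'
  exact ⟨S', exists_exp_conj_starProjection h h' hc⟩

/-! ### Nullity and rank of coordinate projections, and permutations -/

/-- The algebraic dimension of a coordinate subspace is the number of its coordinates, as long as
only finite values and `∞` are distinguished. -/
theorem toENat_rank_coordSubspace (b : HilbertBasis ℕ ℂ H) (S : Set ℕ) :
    Cardinal.toENat (Module.rank ℂ (coordSubspace b S)) = Cardinal.toENat (Cardinal.mk S) := by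
  have hli : LinearIndependent ℂ
      (fun n : S => (⟨b n, basis_mem_coordSubspace b n.2⟩ : coordSubspace b S)) :=
    LinearIndependent.of_comp (coordSubspace b S).subtype
      (b.orthonormal.linearIndependent.comp _ Subtype.val_injective)
  have hle := hli.cardinal_lift_le_rank
  rw [Cardinal.lift_uzero] at hle
  have hle' := OrderHomClass.mono Cardinal.toENat hle
  rw [Cardinal.toENat_lift] at hle'
  refine le_antisymm ?_ hle'
  rcases S.finite_or_infinite with hfin | hinf
  · have hspan : coordSubspace b S ≤ Submodule.span ℂ (b '' S) := fun v hv => by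
      have hv' : v = ∑ n ∈ hfin.toFinset, (inner ℂ (b n) v : ℂ) • b n := by
        refine eq_of_inner_basis b fun m => ?_
        simp only [inner_sum, inner_smul_right, inner_basis, mul_ite, mul_one, mul_zero,
          Finset.sum_ite_eq, Set.Finite.mem_toFinset]
        split_ifs with hm
        · rfl
        · exact mem_coordSubspace.mp hv m (mt hfin.mem_toFinset.mpr hm)
      rw [hv']
      exact Submodule.sum_mem _ fun n hn => Submodule.smul_mem _ _
        (Submodule.subset_span ⟨n, hfin.mem_toFinset.mp hn, rfl⟩)
    have h1 := OrderHomClass.mono Cardinal.toENat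
      ((Submodule.rank_mono hspan).trans (rank_span_le _))
    refine h1.trans ?_
    have h2 := OrderHomClass.mono Cardinal.toENat (Cardinal.mk_image_le_lift (f := b) (s := S))
    simpa using h2
  · have : Infinite S := hinf.to_subtype
    rw [(Cardinal.toENat_eq_top (c := Cardinal.mk S)).mpr (Cardinal.aleph0_le_mk S)]
    exact le_top

theorem rank_coordProj (b : HilbertBasis ℕ ℂ H) (S : Set ℕ) :
    rank (coordProj b S) = Cardinal.toENat (Cardinal.mk S) := by
  have : LinearMap.range (coordProj b S : H →ₗ[ℂ] H) = coordSubspace b S :=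
    Submodule.range_starProjection _
  rw [rank, this, toENat_rank_coordSubspace]

theorem nullity_coordProj (b : HilbertBasis ℕ ℂ H) (S : Set ℕ) :
    nullity (coordProj b S) = Cardinal.toENat (Cardinal.mk ↥(Sᶜ)) := by
  have : LinearMap.ker (coordProj b S : H →ₗ[ℂ] H) = coordSubspace b Sᶜ :=
    (Submodule.ker_starProjection _).trans (orthogonal_coordSubspace b S)
  rw [nullity, this, toENat_rank_coordSubspace]

theorem rank_unitary_conj (u : unitary (H →L[ℂ] H)) (T : H →L[ℂ] H) :
    rank ((u : H →L[ℂ] H) * T * star (u : H →L[ℂ] H)) = rank T := by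
  set e : H ≃ₗ[ℂ] H := (Unitary.linearIsometryEquiv u).toLinearEquiv
  have h : LinearMap.range (((u : H →L[ℂ] H) * T * star (u : H →L[ℂ] H) : H →L[ℂ] H) : H →ₗ[ℂ] H)
      = (LinearMap.range (T : H →ₗ[ℂ] H)).map (e : H →ₗ[ℂ] H) := by
    ext y
    constructor
    · rintro ⟨x, rfl⟩
      exact ⟨T (star (u : H →L[ℂ] H) x), ⟨_, rfl⟩, rfl⟩
    · rintro ⟨_, ⟨x, rfl⟩, rfl⟩
      refine ⟨(u : H →L[ℂ] H) x, ?_⟩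
      change ((u : H →L[ℂ] H) * T * star (u : H →L[ℂ] H) * (u : H →L[ℂ] H)) x
        = (u : H →L[ℂ] H) (T x)
      rw [mul_assoc, Unitary.star_mul_self_of_mem u.2, mul_one]
      rfl
  rw [rank, rank, h, LinearEquiv.rank_map_eq]

theorem nullity_unitary_conj (u : unitary (H →L[ℂ] H)) (T : H →L[ℂ] H) :
    nullity ((u : H →L[ℂ] H) * T * star (u : H →L[ℂ] H)) = nullity T := by
  set e : H ≃ₗ[ℂ] H := (Unitary.linearIsometryEquiv u).toLinearEquiv
  have hu1 (x : H) : (star (u : H →L[ℂ] H)) ((u : H →L[ℂ] H) x) = x := by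
    rw [← mul_apply_eq_comp, Unitary.star_mul_self_of_mem u.2]; rfl
  have hu2 (x : H) : (u : H →L[ℂ] H) ((star (u : H →L[ℂ] H)) x) = x := by
    rw [← mul_apply_eq_comp, Unitary.mul_star_self_of_mem u.2]; rfl
  have h : LinearMap.ker (((u : H →L[ℂ] H) * T * star (u : H →L[ℂ] H) : H →L[ℂ] H) : H →ₗ[ℂ] H)
      = (LinearMap.ker (T : H →ₗ[ℂ] H)).map (e : H →ₗ[ℂ] H) := by
    ext y
    constructor
    · intro hy
      have hy' : (u : H →L[ℂ] H) (T (star (u : H →L[ℂ] H) y)) = 0 := hy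
      refine ⟨star (u : H →L[ℂ] H) y, ?_, hu2 y⟩
      have := hu1 (T (star (u : H →L[ℂ] H) y))
      rw [hy', map_zero] at this
      exact this.symm
    · rintro ⟨x, hx, rfl⟩
      have hx' : T x = 0 := hx
      change (u : H →L[ℂ] H) (T (star (u : H →L[ℂ] H) ((u : H →L[ℂ] H) x))) = 0
      rw [hu1, hx', map_zero]
  rw [nullity, nullity, h, LinearEquiv.rank_map_eq]

theorem exists_perm_mem_iff {S S' : Set ℕ}
    (h : Cardinal.toENat (Cardinal.mk S) = Cardinal.toENat (Cardinal.mk S'))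
    (hc : Cardinal.toENat (Cardinal.mk ↥(Sᶜ)) = Cardinal.toENat (Cardinal.mk ↥(S'ᶜ))) :
    ∃ σ : Equiv.Perm ℕ, ∀ n, σ n ∈ S' ↔ n ∈ S := by
  classical
  obtain ⟨e⟩ := Cardinal.eq.mp ((Cardinal.toENat_eq_iff_of_le_aleph0 Cardinal.mk_le_aleph0
    Cardinal.mk_le_aleph0).mp h)
  obtain ⟨f⟩ := Cardinal.eq.mp ((Cardinal.toENat_eq_iff_of_le_aleph0 Cardinal.mk_le_aleph0
    Cardinal.mk_le_aleph0).mp hc)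
  refine ⟨((Equiv.Set.sumCompl S).symm.trans (e.sumCongr f)).trans (Equiv.Set.sumCompl S'),
    fun n => ?_⟩
  by_cases hn : n ∈ S
  · simp [Equiv.Set.sumCompl_symm_apply_of_mem hn, hn]
  · simp only [Equiv.trans_apply, Equiv.Set.sumCompl_symm_apply_of_notMem hn, hn, iff_false]
    exact (f ⟨n, hn⟩).2

theorem permUnitary_conj_coordProj (b : HilbertBasis ℕ ℂ H) {S S' : Set ℕ} {σ : Equiv.Perm ℕ}
    (hσ : ∀ n, σ n ∈ S' ↔ n ∈ S) :
    (permUnitary b σ : H →L[ℂ] H) * coordProj b S * star (permUnitary b σ : H →L[ℂ] H)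
      = coordProj b S' := by
  refine ext_hilbertBasis b fun n => ?_
  have h := hσ (σ.symm n)
  rw [Equiv.apply_symm_apply] at h
  rw [mul_apply_eq_comp, mul_apply_eq_comp, star_permUnitary_apply_basis, coordProj_apply_basis,
    map_smul, permUnitary_apply_basis, Equiv.apply_symm_apply, coordProj_apply_basis]
  by_cases hn : σ.symm n ∈ S
  · rw [if_pos hn, if_pos (h.mpr hn)]
  · rw [if_neg hn, if_neg (mt h.mp hn)]

end DiagonalPlusCompact

theorem mainTheorem11 {H : Type*} [NormedAddCommGroup H] [InnerProductSpace ℂ H] [CompleteSpace H]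
    (b : HilbertBasis ℕ ℂ H) (P Q : DiagonalPlusCompact.dk b)
    (hP : IsStarProjection P) (hQ : IsStarProjection Q)
    (hnull : DiagonalPlusCompact.nullity (P : H →L[ℂ] H)
      = DiagonalPlusCompact.nullity (Q : H →L[ℂ] H))
    (hrank : DiagonalPlusCompact.rank (P : H →L[ℂ] H)
      = DiagonalPlusCompact.rank (Q : H →L[ℂ] H)) :
    ∃ (X Y : H →L[ℂ] H) (hX : IsSelfAdjoint X) (hY : IsSelfAdjoint Y)
      (hXc : IsCompactOperator X) (hYc : IsCompactOperator Y) (σ : Equiv.Perm ℕ),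
      (DiagonalPlusCompact.thetaExp b Y hY hYc * DiagonalPlusCompact.thetaPerm b σ *
        DiagonalPlusCompact.thetaExp b (-X) hX.neg hXc.neg) P = Q := by
  open DiagonalPlusCompact in
  have hcoe {T : dk b} (hT : IsStarProjection T) : IsStarProjection (T : H →L[ℂ] H) :=
    hT.map (dk b).subtype
  obtain ⟨S, X, hX, hXc, hXP⟩ := exists_exp_conj_coordProj b P.2 (hcoe hP)
  obtain ⟨S', Y, hY, hYc, hYQ⟩ := exists_exp_conj_coordProj b Q.2 (hcoe hQ)
  have hn : nullity (coordProj b S) = nullity (coordProj b S') := by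
    rw [← nullity_unitary_conj (expUnitary X hX) (coordProj b S),
      ← nullity_unitary_conj (expUnitary Y hY) (coordProj b S')]
    rwa [coe_expUnitary, coe_expUnitary, hXP, hYQ]
  have hr : rank (coordProj b S) = rank (coordProj b S') := by
    rw [← rank_unitary_conj (expUnitary X hX) (coordProj b S),
      ← rank_unitary_conj (expUnitary Y hY) (coordProj b S')]
    rwa [coe_expUnitary, coe_expUnitary, hXP, hYQ]
  rw [nullity_coordProj, nullity_coordProj] at hn
  rw [rank_coordProj, rank_coordProj] at hr
  obtain ⟨σ, hσ⟩ := exists_perm_mem_iff hr hn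
  refine ⟨X, Y, hX, hY, hXc, hYc, σ, Subtype.ext ?_⟩
  have hneg : (expUnitary (-X) hX.neg : H →L[ℂ] H) = star (expUnitary X hX : H →L[ℂ] H) := by
    rw [coe_expUnitary, coe_expUnitary, NormedSpace.star_exp, star_smul, hX.star_eq]
    simp
  have h1 : (thetaExp b (-X) hX.neg hXc.neg P : H →L[ℂ] H) = coordProj b S := by
    have huu : star (expUnitary X hX : H →L[ℂ] H) * (expUnitary X hX : H →L[ℂ] H) = 1 :=
      Unitary.star_mul_self_of_mem (expUnitary X hX).2
    rw [thetaExp, coe_ad_apply, hneg, star_star, ← hXP, ← coe_expUnitary X hX]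
    simp only [mul_assoc, huu, mul_one]
    rw [← mul_assoc, huu, one_mul]
  change (thetaExp b Y hY hYc (thetaPerm b σ (thetaExp b (-X) hX.neg hXc.neg P)) : H →L[ℂ] H) = Q
  rw [thetaExp, coe_ad_apply, thetaPerm, coe_ad_apply, h1, permUnitary_conj_coordProj b hσ,
    coe_expUnitary, hYQ]
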